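/- For a Boolean function $f:\{-1,1\}^n\to\{-1,1\}$ and $S\subseteq\{1,\dots,n\}$ let $\hat f(S)=2^{-n}\sum_{x}f(x)\prod_{i\in S}x_i$. Each call to the Fourier sampling oracle $\mathrm{FS}(f)$ returns, independently of all other calls, each subset $S\subseteq\{1,\dots,n\}$ with probability $\hat f(S)^2$. The function $f$ is a $k$-junta if it depends only on at most $k$ of its $n$ variables, and it is $\epsilon$-far from every $k$-junta if for every $k$-junta $g:\{-1,1\}^n\to\{-1,1\}$ it differs from $g$ on at least an $\epsilon$ fraction of $\{-1,1\}^n$. An $\mathrm{FS}$-algorithm is a randomized, adaptive algorithm whose only access to the unknown $f$ is through calls to $\mathrm{FS}(f)$; it tests $k$-juntas with distance parameter $\epsilon$ if, for every $f:\{-1,1\}^n\to\{-1,1\}$, it accepts with probability at least $2/3$ when $f$ is a $k$-junta, and rejects with probability at least $2/3$ when $f$ is $\epsilon$-far from every $k$-junta. Theorem. Testing $k$-juntas requires $\Omega(\sqrt k)$ calls to the $\mathrm{FS}$ oracle. Precisely, there is an absolute constant $c>0$ such that for all integers $n,k\ge 0$ with $n\ge \tfrac32 k$ and all $0<\epsilon\le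 1/6$: if an $\mathrm{FS}$-algorithm tests $k$-juntas over $\{-1,1\}^n$ with distance parameter $\epsilon$ and, on every unknown function, makes at most $N$ oracle calls, then $N\ge c\sqrt k$. -/

import Mathlib

noncomputable section

/-- The Boolean cube `{-1,1}^n`; the units of `ℤ` are exactly `1` and `-1`. -/
abbrev Cube (n : ℕ) : Type := Fin n → ℤˣ

/-- Boolean functions `{-1,1}^n → {-1,1}`. -/
abbrev BoolFun (n : ℕ) : Type := Cube n → ℤˣ

/-- The parity function `χ_S(x) = ∏_{i ∈ S} x_i`. -/
def parity {n : ℕ} (S : Finset (Fin n)) (x : Cube n) : ℝ :=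
  ∏ i ∈ S, ((x i : ℤ) : ℝ)

/-- The Fourier coefficient `2^{-n} ∑_x f(x) χ_S(x)`. -/
def boolFourierCoeff {n : ℕ} (f : BoolFun n) (S : Finset (Fin n)) : ℝ :=
  (1 / 2 ^ n) * ∑ x : Cube n, ((f x : ℤ) : ℝ) * parity S x

theorem sum_parity_mul_parity {n : ℕ} (x y : Cube n) :
    ∑ S : Finset (Fin n), parity S x * parity S y = if x = y then (2 : ℝ) ^ n else 0 := by
  have h : ∑ S : Finset (Fin n), parity S x * parity S y
      = ∏ i : Fin n, (1 + ((x i : ℤ) : ℝ) * ((y i : ℤ) : ℝ)) := by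
    rw [Finset.prod_one_add, Finset.powerset_univ]
    simp only [parity, Finset.prod_mul_distrib]
  rw [h]
  split_ifs with hxy
  · subst hxy
    have : ∀ i : Fin n, (1 + ((x i : ℤ) : ℝ) * ((x i : ℤ) : ℝ)) = 2 := by
      intro i
      rcases Int.units_eq_one_or (x i) with hi | hi <;> rw [hi] <;> norm_num
    simp [this]
  · obtain ⟨i, hi⟩ := Function.ne_iff.mp hxy
    apply Finset.prod_eq_zero (Finset.mem_univ i)
    rcases Int.units_eq_one_or (x i) with h1 | h1 <;>
      rcases Int.units_eq_one_or (y i) with h2 | h2 <;> simp_all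

/-- Parseval's identity for Boolean functions. -/
theorem sum_boolFourierCoeff_sq {n : ℕ} (f : BoolFun n) :
    ∑ S : Finset (Fin n), boolFourierCoeff f S ^ 2 = 1 := by
  have h1 : ∀ S : Finset (Fin n), boolFourierCoeff f S ^ 2 =
      (1 / 2 ^ n) ^ 2 * ∑ x : Cube n, ∑ y : Cube n,
        ((f x : ℤ) : ℝ) * ((f y : ℤ) : ℝ) * (parity S x * parity S y) := by
    intro S
    rw [boolFourierCoeff, mul_pow, sq (∑ x : Cube n, _), Finset.sum_mul_sum]
    congr 1
    refine Finset.sum_congr rfl fun x _ => Finset.sum_congr rfl fun y _ => ?_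
    ring
  have h2 : ∑ S : Finset (Fin n), ∑ x : Cube n, ∑ y : Cube n,
        ((f x : ℤ) : ℝ) * ((f y : ℤ) : ℝ) * (parity S x * parity S y) =
      ∑ x : Cube n, (2 : ℝ) ^ n := by
    rw [Finset.sum_comm]
    refine Finset.sum_congr rfl fun x _ => ?_
    rw [Finset.sum_comm]
    simp only [← Finset.mul_sum, sum_parity_mul_parity]
    rcases Int.units_eq_one_or (f x) with h | h <;> simp [h]
  simp only [h1]
  rw [← Finset.mul_sum, h2]
  simp only [Finset.sum_const, Finset.card_univ, Fintype.card_fun, Fintype.card_units_int,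
    Fintype.card_fin, nsmul_eq_mul]
  push_cast
  field_simp

/-- The Fourier sampling oracle: the distribution of one response, which is
`S` with probability `|f̂(S)|²`. -/
def FS {n : ℕ} (f : BoolFun n) : PMF (Finset (Fin n)) :=
  PMF.ofFintype (fun S => ENNReal.ofReal (boolFourierCoeff f S ^ 2)) (by
    rw [← ENNReal.ofReal_sum_of_nonneg (fun S _ => sq_nonneg _), sum_boolFourierCoeff_sq,
      ENNReal.ofReal_one])

/-- `f` depends only on (at most) `k` of its `n` variables. -/
def IsJunta {n : ℕ} (k : ℕ) (f : BoolFun n) : Prop :=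
  ∃ J : Finset (Fin n), J.card ≤ k ∧ DependsOn f (J : Set (Fin n))

/-- The fraction of inputs on which `f` and `g` differ. -/
def relDist {n : ℕ} (f g : BoolFun n) : ℝ :=
  ((Finset.univ.filter fun x : Cube n => f x ≠ g x).card : ℝ) / 2 ^ n

/-- `f` is `ε`-far from every `k`-junta. -/
def FarFromJuntas {n : ℕ} (k : ℕ) (ε : ℝ) (f : BoolFun n) : Prop :=
  ∀ g : BoolFun n, IsJunta k g → ε ≤ relDist f g

/-- An arbitrary randomized, adaptive algorithm whose only access to the unknown function on `n`
variables is through calls to the Fourier sampling oracle. It either halts with an output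
(`true` for accept, `false` for reject), or uses internal randomness and continues depending on
the result, or calls the oracle (which takes no input) and continues depending on the response.
Internal computation is free and unrestricted. -/
inductive FSAlgorithm (n : ℕ) : Type
  | halt (output : Bool) : FSAlgorithm n
  | random (p : PMF ℕ) (next : ℕ → FSAlgorithm n) : FSAlgorithm n
  | call (next : Finset (Fin n) → FSAlgorithm n) : FSAlgorithm n

namespace FSAlgorithm

/-- The joint distribution of the output and of the number of oracle calls made when the
algorithm is run with the oracle `FS f`; responses to distinct calls are independent. -/
def run {n : ℕ} (f : BoolFun n) : FSAlgorithm n → PMF (Bool × ℕ)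
  | halt b => PMF.pure (b, 0)
  | random p next => p.bind fun i => run f (next i)
  | call next => (FS f).bind fun S => (run f (next S)).map fun o => (o.1, o.2 + 1)

/-- The distribution of the output when the unknown function is `f`. -/
def output {n : ℕ} (A : FSAlgorithm n) (f : BoolFun n) : PMF Bool :=
  (A.run f).map Prod.fst

/-- On every unknown function, no run of the algorithm that has positive probability makes more
than `N` oracle calls. -/
def MakesAtMost {n : ℕ} (A : FSAlgorithm n) (N : ℕ) : Prop :=
  ∀ f : BoolFun n, ∀ o ∈ (A.run f).support, o.2 ≤ N

/-- Property tester for `k`-juntas with distance parameter `ε`. -/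
def TestsJunta {n : ℕ} (A : FSAlgorithm n) (k : ℕ) (ε : ℝ) : Prop :=
  (∀ f : BoolFun n, IsJunta k f → 2 / 3 ≤ A.output f true) ∧
  (∀ f : BoolFun n, FarFromJuntas k ε f → 2 / 3 ≤ A.output f false)

end FSAlgorithm

end

/-!
The signed addressing function with address map `τ` and signs `s` takes `r` address bits `x` and
`M` data bits `y` to `s x * y (τ x)`. Each set of positive Fourier weight contains exactly one data
bit `j`, and the total weight of the sets with data bit `j` is the probability that a random
address is sent to `j`.

Permute the data bits at random and choose the signs at random. By symmetry, all sequences of `N`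
responses with pairwise distinct data bits are then equally likely, whatever `τ` is. If no data bit
has probability more than `4 / k`, the data bits of `N` responses are pairwise distinct except with
probability at most `4 * N ^ 2 / k`, as in the birthday paradox. So an algorithm with far fewer than
`√k` calls cannot tell two such maps `τ` apart.

Take `r` of the order of `log k`. If `τ` spreads the addresses evenly over `k - r` data bits, the
function is a `k`-junta. If `τ` spreads them over about `3 * k / 2` data bits, then a `k`-junta `g`
either ignores some address bit, and has correlation at most `1 / 2` with the function, because
flipping this bit changes the data bit that is read; or it depends on fewer than `2 / 3` of the
data bits, and the correlation is at most `2 / 3`. In both cases `g` is at distance at least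
`1 / 6`.
-/

noncomputable section

open Finset
open scoped BigOperators

/-! ### Independent samples -/

theorem bind_congr_of_mem_support {α β : Type*} {p : PMF α} {f g : α → PMF β}
    (h : ∀ a ∈ p.support, f a = g a) : p.bind f = p.bind g := by
  ext b
  simp only [PMF.bind_apply]
  refine tsum_congr fun a => ?_
  by_cases ha : a ∈ p.support
  · rw [h a ha]
  · rw [(p.apply_eq_zero_iff a).2 ha, zero_mul, zero_mul]

section Samples

variable {α : Type*} [Fintype α]

/-- The distribution of `N` independent samples from `p`. -/
def iidSample (p : PMF α) (N : ℕ) : PMF (Fin N → α) :=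
  PMF.ofFintype (fun v => ∏ i, p (v i)) (by
    rw [← Fintype.sum_pow, ← tsum_fintype (L := .unconditional α), p.tsum_coe, one_pow])

theorem iidSample_apply (p : PMF α) {N : ℕ} (v : Fin N → α) :
    iidSample p N v = ∏ i, p (v i) :=
  rfl

theorem iidSample_zero_eq (p q : PMF α) : iidSample p 0 = iidSample q 0 :=
  PMF.ext fun v => by simp [iidSample_apply]

theorem iidSample_succ_bind {β : Type*} (p : PMF α) (N : ℕ) (g : (Fin (N + 1) → α) → PMF β) :
    (iidSample p (N + 1)).bind g =
      p.bind fun a => (iidSample p N).bind fun v => g (Fin.cons a v) := by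
  ext b
  simp only [PMF.bind_apply, tsum_fintype, iidSample_apply, mul_sum]
  rw [← (Fin.consEquiv fun _ => α).sum_comp, Fintype.sum_prod_type]
  simp [Fin.consEquiv, Fin.prod_univ_succ, mul_assoc]

theorem sum_embedding_prod_succ (p : α → ℝ) (N : ℕ) :
    ∑ e : Fin (N + 1) ↪ α, ∏ i, p (e i) =
      ∑ e : Fin N ↪ α, (∏ i, p (e i)) * (∑ a, p a - ∑ i, p (e i)) := by
  classical
  rw [← (Equiv.embeddingFinSucc N α).symm.sum_comp, Fintype.sum_sigma]
  refine Fintype.sum_congr _ _ fun e => ?_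
  have hrange : ∑ i, p (e i) = ∑ a : {a // a ∈ Set.range e}, p a :=
    Fintype.sum_equiv (Equiv.ofInjective e e.injective) _ (fun a => p a) fun _ => rfl
  have hcompl : ∑ a : {a // a ∉ Set.range e}, p a = ∑ a, p a - ∑ i, p (e i) := by
    rw [hrange, eq_sub_iff_add_eq']
    convert Fintype.sum_subtype_add_sum_subtype (· ∈ Set.range e) p
  simp only [Equiv.coe_embeddingFinSucc_symm, Fin.prod_univ_succ, Fin.cons_zero, Fin.cons_succ]
  rw [← sum_mul, hcompl, mul_comm]

theorem sum_embedding_prod_le_one {p : α → ℝ} (hp₀ : ∀ a, 0 ≤ p a) (hp₁ : ∑ a, p a = 1)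
    (N : ℕ) : ∑ e : Fin N ↪ α, ∏ i, p (e i) ≤ 1 := by
  classical
  calc ∑ e : Fin N ↪ α, ∏ i, p (e i)
      = ∑ v ∈ univ.map ⟨((↑) : (Fin N ↪ α) → Fin N → α), DFunLike.coe_injective⟩,
          ∏ i, p (v i) := by rw [sum_map]; rfl
    _ ≤ ∑ v : Fin N → α, ∏ i, p (v i) :=
        sum_le_univ_sum_of_nonneg fun v => prod_nonneg fun i _ => hp₀ (v i)
    _ = 1 := by rw [← Fintype.sum_pow, hp₁, one_pow]

theorem one_sub_sq_mul_le_sum_embedding_prod {p : α → ℝ} {β : ℝ} (hp₀ : ∀ a, 0 ≤ p a)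
    (hp₁ : ∑ a, p a = 1) (hβ : ∀ a, p a ≤ β) (N : ℕ) :
    1 - (N : ℝ) ^ 2 * β ≤ ∑ e : Fin N ↪ α, ∏ i, p (e i) := by
  have hβ₀ : 0 ≤ β := by
    obtain ⟨a, -, -⟩ := exists_ne_zero_of_sum_ne_zero (hp₁.symm ▸ one_ne_zero)
    exact (hp₀ a).trans (hβ a)
  induction N with
  | zero => simp
  | succ N ih =>
    have hused (e : Fin N ↪ α) : ∑ i, p (e i) ≤ N * β := by
      simpa using sum_le_card_nsmul univ (fun i => p (e i)) β fun i _ => hβ (e i)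
    have hstep : (∑ e : Fin N ↪ α, ∏ i, p (e i)) * (1 - N * β) ≤
        ∑ e : Fin (N + 1) ↪ α, ∏ i, p (e i) := by
      rw [sum_embedding_prod_succ, sum_mul, hp₁]
      exact sum_le_sum fun e _ => mul_le_mul_of_nonneg_left (sub_le_sub_left (hused e) 1)
        (prod_nonneg fun i _ => hp₀ (e i))
    have hlost : (∑ e : Fin N ↪ α, ∏ i, p (e i)) * (N * β) ≤ N * β :=
      mul_le_of_le_one_left (by positivity) (sum_embedding_prod_le_one hp₀ hp₁ N)
    push_cast
    nlinarith [mul_nonneg N.cast_nonneg hβ₀]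

end Samples

/-- The point is that `p - q` has constant sign on `V`, so that its positive part has mass at most
`δ`, and not `2 * δ`. -/
theorem sum_mul_sub_sum_mul_le {α : Type*} [Fintype α] {p q w : α → ℝ} {V : Finset α} {δ : ℝ}
    (hp₀ : ∀ a, 0 ≤ p a) (hq₀ : ∀ a, 0 ≤ q a) (hp₁ : ∑ a, p a = 1)
    (hpV : ∀ a ∈ V, ∀ b ∈ V, p a = p b) (hqV : ∀ a ∈ V, ∀ b ∈ V, q a = q b)
    (hpδ : 1 - δ ≤ ∑ a ∈ V, p a) (hqδ : 1 - δ ≤ ∑ a ∈ V, q a)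
    (hw : ∀ a, w a ∈ Set.Icc 0 1) :
    ∑ a, p a * w a - ∑ a, q a * w a ≤ δ := by
  classical
  have hsplit : ∑ a ∈ V, (p a - q a) * w a + ∑ a ∈ Vᶜ, (p a - q a) * w a =
      ∑ a, p a * w a - ∑ a, q a * w a := by
    rw [sum_add_sum_compl, ← sum_sub_distrib]
    simp only [sub_mul]
  have hcompl : ∑ a ∈ Vᶜ, (p a - q a) * w a ≤ 1 - ∑ a ∈ V, p a := by
    rw [← hp₁, ← sum_add_sum_compl V p, add_sub_cancel_left]
    exact sum_le_sum fun a _ => by nlinarith [hp₀ a, hq₀ a, (hw a).1, (hw a).2]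
  rw [← hsplit]
  by_cases hle : ∀ a ∈ V, p a ≤ q a
  · have hV : ∑ a ∈ V, (p a - q a) * w a ≤ 0 :=
      sum_nonpos fun a ha => mul_nonpos_of_nonpos_of_nonneg (sub_nonpos.2 (hle a ha)) (hw a).1
    linarith
  · push Not at hle
    obtain ⟨b, hb, hlt⟩ := hle
    have hV : ∑ a ∈ V, (p a - q a) * w a ≤ ∑ a ∈ V, p a - ∑ a ∈ V, q a := by
      rw [← sum_sub_distrib]
      refine sum_le_sum fun a ha => mul_le_of_le_one_right ?_ (hw a).2
      rw [hpV a ha b hb, hqV a ha b hb]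
      exact sub_nonneg.2 hlt.le
    linarith

/-! ### Algorithms as functions of the oracle responses -/

section Algorithms

variable {n : ℕ}

/-- The probability that `N` independent calls to `FS f` return the responses `S`. -/
def responseProb {N : ℕ} (f : BoolFun n) (S : Fin N → Finset (Fin n)) : ℝ :=
  ∏ i, boolFourierCoeff f (S i) ^ 2

theorem responseProb_nonneg {N : ℕ} (f : BoolFun n) (S : Fin N → Finset (Fin n)) :
    0 ≤ responseProb f S :=
  prod_nonneg fun _ _ => sq_nonneg _

theorem sum_responseProb (f : BoolFun n) (N : ℕ) :
    ∑ S : Fin N → Finset (Fin n), responseProb f S = 1 := by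
  simp only [responseProb]
  rw [← Fintype.sum_pow fun S => boolFourierCoeff f S ^ 2, sum_boolFourierCoeff_sq, one_pow]

theorem toReal_iidSample_FS {N : ℕ} (f : BoolFun n) (S : Fin N → Finset (Fin n)) :
    (iidSample (FS f) N S).toReal = responseProb f S := by
  simp [iidSample_apply, FS, PMF.ofFintype_apply, ENNReal.toReal_prod, responseProb, sq_nonneg]

namespace FSAlgorithm

/-- The distribution of the output when the oracle responses are read off a list. A run that asks
for more responses than the list holds rejects; this case has probability `0` on lists as long as
the number of calls. -/
def outputOn : FSAlgorithm n → List (Finset (Fin n)) → PMF Bool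
  | halt b, _ => PMF.pure b
  | random p next, l => p.bind fun i => outputOn (next i) l
  | call _, [] => PMF.pure false
  | call next, S :: l => outputOn (next S) l

theorem output_random (p : PMF ℕ) (next : ℕ → FSAlgorithm n) (f : BoolFun n) :
    (random p next).output f = p.bind fun i => (next i).output f := by
  simp only [output, run, PMF.map_bind]

theorem output_call (next : Finset (Fin n) → FSAlgorithm n) (f : BoolFun n) :
    (call next).output f = (FS f).bind fun S => (next S).output f := by
  simp only [output, run, PMF.map_bind, PMF.map_comp]
  rfl

theorem output_eq_iidSample_bind (f : BoolFun n) (A : FSAlgorithm n) {N : ℕ}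
    (hN : ∀ o ∈ (A.run f).support, o.2 ≤ N) :
    A.output f = (iidSample (FS f) N).bind fun S => A.outputOn (List.ofFn S) := by
  induction A generalizing N with
  | halt b => simp only [output, run, outputOn, PMF.pure_map, PMF.bind_const]
  | random p next ih =>
    simp only [output_random, outputOn]
    rw [PMF.bind_comm]
    refine bind_congr_of_mem_support fun i hi => ih i fun o ho => hN o ?_
    exact (PMF.mem_support_bind_iff _ _ _).2 ⟨i, hi, ho⟩
  | call next ih =>
    have hnext : ∀ S ∈ (FS f).support, ∀ o ∈ ((next S).run f).support, o.2 + 1 ≤ N :=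
      fun S hS o ho => hN (o.1, o.2 + 1) <| (PMF.mem_support_bind_iff _ _ _).2
        ⟨S, hS, (PMF.mem_support_map_iff _ _ _).2 ⟨o, ho, rfl⟩⟩
    obtain ⟨S₀, hS₀⟩ := (FS f).support_nonempty
    obtain ⟨o₀, ho₀⟩ := ((next S₀).run f).support_nonempty
    obtain ⟨N, rfl⟩ := Nat.exists_eq_succ_of_ne_zero (Nat.ne_zero_of_lt (hnext S₀ hS₀ o₀ ho₀))
    rw [output_call, iidSample_succ_bind]
    simp only [List.ofFn_cons, outputOn]
    exact bind_congr_of_mem_support fun S hS =>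
      ih S fun o ho => Nat.le_of_succ_le_succ (hnext S hS o ho)

/-- The probability of acceptance given the oracle responses `S`. -/
def acceptProb (A : FSAlgorithm n) {N : ℕ} (S : Fin N → Finset (Fin n)) : ℝ :=
  (A.outputOn (List.ofFn S) true).toReal

theorem acceptProb_mem_Icc (A : FSAlgorithm n) {N : ℕ} (S : Fin N → Finset (Fin n)) :
    A.acceptProb S ∈ Set.Icc 0 1 :=
  ⟨ENNReal.toReal_nonneg, ENNReal.toReal_le_of_le_ofReal zero_le_one
    (by simpa using PMF.coe_le_one _ _)⟩

theorem MakesAtMost.toReal_output_true {A : FSAlgorithm n} {N : ℕ} (hN : A.MakesAtMost N)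
    (f : BoolFun n) :
    (A.output f true).toReal =
      ∑ S : Fin N → Finset (Fin n), responseProb f S * A.acceptProb S := by
  rw [output_eq_iidSample_bind f A (hN f), PMF.bind_apply, tsum_fintype, ENNReal.toReal_sum
    fun S _ => ENNReal.mul_ne_top (PMF.apply_ne_top _ _) (PMF.apply_ne_top _ _)]
  simp only [ENNReal.toReal_mul, toReal_iidSample_FS, acceptProb]

theorem MakesAtMost.output_eq_of_zero {A : FSAlgorithm n} (hN : A.MakesAtMost 0)
    (f g : BoolFun n) : A.output f = A.output g := by
  rw [output_eq_iidSample_bind f A (hN f), output_eq_iidSample_bind g A (hN g),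
    iidSample_zero_eq]

theorem TestsJunta.two_thirds_le_of_isJunta {A : FSAlgorithm n} {k : ℕ} {ε : ℝ}
    (hA : A.TestsJunta k ε) {f : BoolFun n} (hf : IsJunta k f) :
    2 / 3 ≤ (A.output f true).toReal := by
  simpa using ENNReal.toReal_mono (PMF.apply_ne_top _ _) (hA.1 f hf)

theorem TestsJunta.le_one_third_of_farFromJuntas {A : FSAlgorithm n} {k : ℕ} {ε : ℝ}
    (hA : A.TestsJunta k ε) {f : BoolFun n} (hf : FarFromJuntas k ε f) :
    (A.output f true).toReal ≤ 1 / 3 := by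
  have hfalse : 2 / 3 ≤ (A.output f false).toReal := by
    simpa using ENNReal.toReal_mono (PMF.apply_ne_top _ _) (hA.2 f hf)
  have htotal : (A.output f true).toReal + (A.output f false).toReal = 1 := by
    rw [← ENNReal.toReal_add (PMF.apply_ne_top _ _) (PMF.apply_ne_top _ _), ← Fintype.sum_bool,
      ← tsum_fintype (L := .unconditional Bool), PMF.tsum_coe, ENNReal.toReal_one]
  linarith

end FSAlgorithm

end Algorithms

/-! ### Correlation of Boolean functions -/

section Correlation

variable {n r M : ℕ}

theorem intUnit_cast_mul_self (u : ℤˣ) : ((u : ℤ) : ℝ) * ((u : ℤ) : ℝ) = 1 := by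
  exact_mod_cast Int.units_coe_mul_self u

theorem intUnit_cast_mul_le_one (u v : ℤˣ) : ((u : ℤ) : ℝ) * ((v : ℤ) : ℝ) ≤ 1 := by
  rcases Int.units_eq_one_or u with rfl | rfl <;> rcases Int.units_eq_one_or v with rfl | rfl <;>
    norm_num

/-- Negation of one coordinate of a point of the cube. -/
def flipAt (i : Fin n) (x : Cube n) : Cube n :=
  Function.update x i (-x i)

@[simp] theorem flipAt_same (i : Fin n) (x : Cube n) : flipAt i x i = -x i := by
  simp [flipAt]

theorem flipAt_of_ne {i j : Fin n} (h : j ≠ i) (x : Cube n) : flipAt i x j = x j := by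
  simp [flipAt, h]

theorem flipAt_involutive (i : Fin n) : Function.Involutive (flipAt i) := fun x => by
  simp [flipAt]

theorem castAdd_ne_natAdd (i : Fin r) (j : Fin M) : Fin.castAdd M i ≠ Fin.natAdd r j :=
  finSumFinEquiv.injective.ne Sum.inl_ne_inr

theorem flipAt_castAdd_append (i : Fin r) (x : Cube r) (y : Cube M) :
    flipAt (Fin.castAdd M i) (Fin.append x y) = Fin.append (flipAt i x) y := by
  ext l
  refine Fin.addCases (fun a => ?_) (fun b => ?_) l
  · simp [flipAt, Function.update_apply]
  · simp [flipAt, (castAdd_ne_natAdd i b).symm]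

theorem flipAt_natAdd_append (j : Fin M) (x : Cube r) (y : Cube M) :
    flipAt (Fin.natAdd r j) (Fin.append x y) = Fin.append x (flipAt j y) := by
  ext l
  refine Fin.addCases (fun a => ?_) (fun b => ?_) l
  · simp [flipAt, castAdd_ne_natAdd]
  · simp [flipAt, Function.update_apply]

theorem expect_flipAt (i : Fin n) (F : Cube n → ℝ) : 𝔼 x, F (flipAt i x) = 𝔼 x, F x :=
  Fintype.expect_equiv (flipAt_involutive i).toPerm _ _ fun _ => rfl

theorem expect_append (F : Cube (r + M) → ℝ) : 𝔼 z, F z = 𝔼 x, 𝔼 y, F (Fin.append x y) := by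
  rw [← expect_product', univ_product_univ]
  exact (Fintype.expect_equiv (Fin.appendEquiv r M) _ _ fun _ => rfl).symm

theorem expect_coord_mul_coord (a b : Fin n) :
    𝔼 y : Cube n, ((y a : ℤ) : ℝ) * ((y b : ℤ) : ℝ) = if a = b then 1 else 0 := by
  split_ifs with hab
  · simp only [hab, intUnit_cast_mul_self, Fintype.expect_const]
  · have hflip := expect_flipAt a fun y : Cube n => ((y a : ℤ) : ℝ) * ((y b : ℤ) : ℝ)
    simp only [flipAt_same, flipAt_of_ne (Ne.symm hab), Units.val_neg, Int.cast_neg, neg_mul,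
      expect_neg_distrib] at hflip
    linarith

/-- The correlation of two Boolean functions: the average of their product over the cube. -/
def correlation (f g : BoolFun n) : ℝ :=
  𝔼 z, ((f z : ℤ) : ℝ) * ((g z : ℤ) : ℝ)

theorem correlation_self (f : BoolFun n) : correlation f f = 1 := by
  simp only [correlation, intUnit_cast_mul_self, Fintype.expect_const]

theorem correlation_neg_right (f g : BoolFun n) : correlation f (-g) = -correlation f g := by
  simp [correlation, expect_neg_distrib]

theorem correlation_le_one (f g : BoolFun n) : correlation f g ≤ 1 :=
  expect_le univ_nonempty fun z _ => intUnit_cast_mul_le_one (f z) (g z)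

theorem correlation_mul_coord (u v : ℤˣ) (a b : Fin n) :
    correlation (fun y => u * y a) (fun y => v * y b) =
      if a = b then ((u : ℤ) : ℝ) * ((v : ℤ) : ℝ) else 0 := by
  simp only [correlation, Units.val_mul, Int.cast_mul, mul_mul_mul_comm, ← mul_expect,
    expect_coord_mul_coord, mul_ite, mul_one, mul_zero]

theorem correlation_append (f g : BoolFun (r + M)) :
    correlation f g =
      𝔼 x, correlation (fun y => f (Fin.append x y)) fun y => g (Fin.append x y) :=
  expect_append _

theorem relDist_eq (f g : BoolFun n) : relDist f g = (1 - correlation f g) / 2 := by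
  have hdiff (z : Cube n) : (if f z ≠ g z then 1 else 0 : ℝ) =
      (1 - ((f z : ℤ) : ℝ) * ((g z : ℤ) : ℝ)) / 2 := by
    rcases Int.units_eq_one_or (f z) with hf | hf <;>
      rcases Int.units_eq_one_or (g z) with hg | hg <;> rw [hf, hg] <;> norm_num
  calc relDist f g = 𝔼 z, if f z ≠ g z then 1 else 0 := by
        rw [Fintype.expect_eq_sum_div_card, sum_boole]
        simp [relDist]
    _ = (1 - correlation f g) / 2 := by
        simp only [hdiff, ← expect_div, expect_sub_distrib, Fintype.expect_const, correlation]

/-- Averaging over the direction `i` replaces `f` by `(f + f ∘ flipAt i) / 2`, whose absolute value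
is `(1 + f * f ∘ flipAt i) / 2`. -/
theorem two_mul_correlation_le {f g : BoolFun n} {i : Fin n} (hg : g ∘ flipAt i = g) :
    2 * correlation f g ≤ 1 + correlation f (f ∘ flipAt i) := by
  have hpoint (z : Cube n) : ((f z : ℤ) : ℝ) * ((g z : ℤ) : ℝ) +
      ((f (flipAt i z) : ℤ) : ℝ) * ((g z : ℤ) : ℝ) ≤
        1 + ((f z : ℤ) : ℝ) * ((f (flipAt i z) : ℤ) : ℝ) := by
    rcases Int.units_eq_one_or (f z) with h | h <;>
      rcases Int.units_eq_one_or (g z) with h' | h' <;>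
        rcases Int.units_eq_one_or (f (flipAt i z)) with h'' | h'' <;> rw [h, h', h''] <;> norm_num
  have hflip : 𝔼 z, ((f (flipAt i z) : ℤ) : ℝ) * ((g z : ℤ) : ℝ) = correlation f g := by
    rw [correlation, ← expect_flipAt i]
    exact expect_congr rfl fun z _ => by
      rw [flipAt_involutive i z, ← congrFun hg z, Function.comp_apply]
  calc 2 * correlation f g
      = 𝔼 z, (((f z : ℤ) : ℝ) * ((g z : ℤ) : ℝ) +
          ((f (flipAt i z) : ℤ) : ℝ) * ((g z : ℤ) : ℝ)) := by
        rw [expect_add_distrib, hflip, ← correlation, two_mul]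
    _ ≤ 𝔼 z, (1 + ((f z : ℤ) : ℝ) * ((f (flipAt i z) : ℤ) : ℝ)) :=
        expect_le_expect fun z _ => hpoint z
    _ = 1 + correlation f (f ∘ flipAt i) := by
        rw [expect_add_distrib, Fintype.expect_const]
        rfl

theorem correlation_nonpos_of_comp_flipAt_eq_neg {f g : BoolFun n} {i : Fin n}
    (hf : f ∘ flipAt i = -f) (hg : g ∘ flipAt i = g) : correlation f g ≤ 0 := by
  have h := two_mul_correlation_le (f := f) hg
  rw [hf, correlation_neg_right, correlation_self] at h
  linarith

theorem comp_flipAt_of_dependsOn {g : BoolFun n} {J : Finset (Fin n)} {i : Fin n}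
    (hg : DependsOn g (J : Set (Fin n))) (hi : i ∉ J) : g ∘ flipAt i = g :=
  funext fun z => hg fun _ hj => flipAt_of_ne (ne_of_mem_of_not_mem hj hi) z

theorem comp_append_flipAt_of_dependsOn {g : BoolFun (r + M)} {J : Finset (Fin (r + M))} {j : Fin M}
    (hg : DependsOn g (J : Set (Fin (r + M)))) (hj : Fin.natAdd r j ∉ J) (x : Cube r) :
    (fun y => g (Fin.append x y)) ∘ flipAt j = fun y => g (Fin.append x y) :=
  funext fun y => by
    simpa [flipAt_natAdd_append] using
      congrFun (comp_flipAt_of_dependsOn hg hj) (Fin.append x y)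

/-- `parity` as a Boolean function. -/
def unitParity (S : Finset (Fin n)) : BoolFun n := fun x => ∏ i ∈ S, x i

theorem unitParity_singleton (i : Fin n) (x : Cube n) : unitParity {i} x = x i :=
  prod_singleton _ _

theorem coe_unitParity (S : Finset (Fin n)) (x : Cube n) :
    ((unitParity S x : ℤ) : ℝ) = parity S x := by
  simp [unitParity, parity, Units.coe_prod]

theorem unitParity_comp_flipAt {S : Finset (Fin n)} {i : Fin n} (hi : i ∈ S) :
    unitParity S ∘ flipAt i = -unitParity S := by
  funext x
  have hne : ∏ l ∈ S.erase i, flipAt i x l = ∏ l ∈ S.erase i, x l :=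
    prod_congr rfl fun l hl => flipAt_of_ne (ne_of_mem_erase hl) x
  simp only [Function.comp_apply, Pi.neg_apply, unitParity, ← mul_prod_erase S _ hi, hne,
    flipAt_same, neg_mul]

theorem boolFourierCoeff_eq_correlation (f : BoolFun n) (S : Finset (Fin n)) :
    boolFourierCoeff f S = correlation f (unitParity S) := by
  simp [boolFourierCoeff, correlation, coe_unitParity, Fintype.expect_eq_sum_div_card,
    div_eq_inv_mul]

theorem sum_expect_mul_parity_sq (a : Cube n → ℝ) :
    ∑ S : Finset (Fin n), (𝔼 x, a x * parity S x) ^ 2 = 𝔼 x, a x ^ 2 := by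
  have hsq (S : Finset (Fin n)) : (𝔼 x, a x * parity S x) ^ 2 =
      𝔼 x, a x * 𝔼 y, a y * (parity S x * parity S y) := by
    rw [sq, expect_mul_expect]
    simp only [mul_expect]
    exact expect_congr rfl fun x _ => expect_congr rfl fun y _ => by ring
  simp only [hsq]
  rw [← expect_sum_comm]
  refine expect_congr rfl fun x _ => ?_
  rw [← mul_sum, ← expect_sum_comm, sq]
  simp only [← mul_sum, sum_parity_mul_parity, Fintype.expect_eq_sum_div_card, mul_ite, mul_zero,
    sum_ite_eq, mem_univ, if_true]
  simp

theorem isJunta_one (k : ℕ) : IsJunta k (1 : BoolFun n) :=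
  ⟨∅, by simp, fun _ _ _ => rfl⟩

theorem farFromJuntas_unitParity_univ {k : ℕ} {ε : ℝ} (hk : k < n) (hε : ε ≤ 1 / 2) :
    FarFromJuntas k ε (unitParity (univ : Finset (Fin n))) := by
  rintro g ⟨J, hJ, hg⟩
  obtain ⟨i, -, hi⟩ :=
    exists_mem_notMem_of_card_lt_card (hJ.trans_lt (hk.trans_eq (card_fin n).symm))
  have hcorr := correlation_nonpos_of_comp_flipAt_eq_neg (unitParity_comp_flipAt (mem_univ i))
    (comp_flipAt_of_dependsOn hg hi)
  rw [relDist_eq]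
  linarith

end Correlation

/-! ### Addressing functions -/

section Addressing

variable {r M k : ℕ}

/-- The set of coordinates of `{-1,1}^(r+M)` that consists of the address bits in `T` and the data
bits in `B`. -/
def coordSet (T : Finset (Fin r)) (B : Finset (Fin M)) : Finset (Fin (r + M)) :=
  (T.disjSum B).map finSumFinEquiv.toEmbedding

theorem castAdd_mem_coordSet {T : Finset (Fin r)} {B : Finset (Fin M)} {i : Fin r} :
    Fin.castAdd M i ∈ coordSet T B ↔ i ∈ T :=
  (mem_map' (a := Sum.inl i) finSumFinEquiv.toEmbedding).trans inl_mem_disjSum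

theorem natAdd_mem_coordSet {T : Finset (Fin r)} {B : Finset (Fin M)} {j : Fin M} :
    Fin.natAdd r j ∈ coordSet T B ↔ j ∈ B :=
  (mem_map' (a := Sum.inr j) finSumFinEquiv.toEmbedding).trans inr_mem_disjSum

theorem card_coordSet (T : Finset (Fin r)) (B : Finset (Fin M)) :
    #(coordSet T B) = #T + #B := by
  rw [coordSet, card_map, card_disjSum]

theorem coordSet_inj {T T' : Finset (Fin r)} {B B' : Finset (Fin M)} :
    coordSet T B = coordSet T' B' ↔ T = T' ∧ B = B' := by
  refine ⟨fun h => ⟨?_, ?_⟩, fun h => by rw [h.1, h.2]⟩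
  · ext i
    rw [← castAdd_mem_coordSet (B := B), h, castAdd_mem_coordSet]
  · ext j
    rw [← natAdd_mem_coordSet (T := T), h, natAdd_mem_coordSet]

theorem unitParity_coordSet_append (T : Finset (Fin r)) (B : Finset (Fin M)) (x : Cube r)
    (y : Cube M) :
    unitParity (coordSet T B) (Fin.append x y) = unitParity T x * unitParity B y := by
  simp [unitParity, coordSet, prod_map, prod_disjSum]

/-- The signed addressing function: at the `r` address bits `x` and the `M` data bits `y` its value
is the data bit `y (τ x)`, multiplied by the sign `s x`. -/
def addressing (τ : Cube r → Fin M) (s : Cube r → ℤˣ) : BoolFun (r + M) := fun z =>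
  s (z ∘ Fin.castAdd M) * z (Fin.natAdd r (τ (z ∘ Fin.castAdd M)))

theorem addressing_append (τ : Cube r → Fin M) (s : Cube r → ℤˣ) (x : Cube r) (y : Cube M) :
    addressing τ s (Fin.append x y) = s x * y (τ x) := by
  have hx : Fin.append x y ∘ Fin.castAdd M = x := funext fun i => Fin.append_left x y i
  rw [addressing, hx, Fin.append_right]

/-- The probability that a uniformly random address leads to the data bit `j`. -/
def addressProb (τ : Cube r → Fin M) (j : Fin M) : ℝ :=
  𝔼 x, if τ x = j then 1 else 0

theorem addressProb_nonneg (τ : Cube r → Fin M) (j : Fin M) : 0 ≤ addressProb τ j :=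
  expect_nonneg fun _ _ => by positivity

theorem sum_filter_addressProb (τ : Cube r → Fin M) (p : Fin M → Prop) [DecidablePred p] :
    ∑ j with p j, addressProb τ j = 𝔼 x, if p (τ x) then 1 else 0 := by
  simp only [addressProb]
  rw [← expect_sum_comm]
  simp

theorem sum_addressProb (τ : Cube r → Fin M) : ∑ j, addressProb τ j = 1 := by
  simpa using sum_filter_addressProb τ fun _ => True

theorem addressProb_perm_comp (τ : Cube r → Fin M) (π : Equiv.Perm (Fin M)) (j : Fin M) :
    addressProb (π ∘ τ) j = addressProb τ (π.symm j) := by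
  simp only [addressProb, Function.comp_apply, Equiv.eq_symm_apply]

theorem boolFourierCoeff_addressing (τ : Cube r → Fin M) (s : Cube r → ℤˣ) (T : Finset (Fin r))
    (j : Fin M) :
    boolFourierCoeff (addressing τ s) (coordSet T {j}) =
      𝔼 x, if τ x = j then ((s x : ℤ) : ℝ) * parity T x else 0 := by
  rw [boolFourierCoeff_eq_correlation, correlation_append]
  refine expect_congr rfl fun x _ => ?_
  simp only [addressing_append, unitParity_coordSet_append, unitParity_singleton,
    correlation_mul_coord, coe_unitParity]

theorem sum_boolFourierCoeff_addressing_sq (τ : Cube r → Fin M) (s : Cube r → ℤˣ) (j : Fin M) :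
    ∑ T, boolFourierCoeff (addressing τ s) (coordSet T {j}) ^ 2 = addressProb τ j := by
  simp only [boolFourierCoeff_addressing, ← ite_zero_mul, sum_expect_mul_parity_sq, addressProb]
  refine expect_congr rfl fun x _ => ?_
  split_ifs <;> simp [sq, intUnit_cast_mul_self]

theorem isJunta_addressing {τ : Cube r → Fin M} {B : Finset (Fin M)} (hτ : ∀ x, τ x ∈ B)
    (hk : r + #B ≤ k) (s : Cube r → ℤˣ) : IsJunta k (addressing τ s) := by
  refine ⟨coordSet univ B, by rwa [card_coordSet, card_fin], fun z z' h => ?_⟩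
  have haddress : z ∘ Fin.castAdd M = z' ∘ Fin.castAdd M :=
    funext fun i => h _ (castAdd_mem_coordSet.2 (mem_univ i))
  rw [addressing, addressing, haddress, h _ (natAdd_mem_coordSet.2 (hτ _))]

theorem correlation_addressing_le_half {τ : Cube r → Fin M} {i : Fin r}
    (hτ : ∀ x, τ (flipAt i x) ≠ τ x) (s : Cube r → ℤˣ) {g : BoolFun (r + M)}
    (hg : g ∘ flipAt (Fin.castAdd M i) = g) : correlation (addressing τ s) g ≤ 1 / 2 := by
  have hauto : correlation (addressing τ s) (addressing τ s ∘ flipAt (Fin.castAdd M i)) = 0 := by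
    rw [correlation_append]
    refine expect_eq_zero fun x _ => ?_
    simp only [Function.comp_apply, flipAt_castAdd_append, addressing_append,
      correlation_mul_coord, if_neg (hτ x).symm]
  have hle := two_mul_correlation_le (f := addressing τ s) hg
  rw [hauto] at hle
  linarith

theorem correlation_addressing_le_sum (τ : Cube r → Fin M) (s : Cube r → ℤˣ)
    {g : BoolFun (r + M)} {J : Finset (Fin (r + M))} (hg : DependsOn g (J : Set (Fin (r + M)))) :
    correlation (addressing τ s) g ≤ ∑ j with Fin.natAdd r j ∈ J, addressProb τ j := by
  rw [sum_filter_addressProb τ fun j => Fin.natAdd r j ∈ J, correlation_append]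
  refine expect_le_expect fun x _ => ?_
  split_ifs with hx
  · exact correlation_le_one _ _
  · simp only [addressing_append]
    refine correlation_nonpos_of_comp_flipAt_eq_neg (i := τ x) ?_
      (comp_append_flipAt_of_dependsOn hg hx x)
    funext y
    simp

theorem farFromJuntas_addressing {τ : Cube r → Fin M} {β ε : ℝ}
    (hτ : ∀ x i, τ (flipAt i x) ≠ τ x) (hβ : ∀ j, addressProb τ j ≤ β)
    (hk : ((k : ℝ) - r) * β ≤ 2 / 3) (hε : ε ≤ 1 / 6) (s : Cube r → ℤˣ) :
    FarFromJuntas k ε (addressing τ s) := by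
  rintro g ⟨J, hJ, hg⟩
  suffices hcorr : correlation (addressing τ s) g ≤ 2 / 3 by
    rw [relDist_eq]
    linarith
  by_cases haddress : ∀ i : Fin r, Fin.castAdd M i ∈ J
  · let B : Finset (Fin M) := {j | Fin.natAdd r j ∈ J}
    have hB : r + #B ≤ k := by
      rw [← card_fin r, ← card_coordSet]
      refine (card_le_card fun l => ?_).trans hJ
      refine Fin.addCases (fun i _ => haddress i) (fun j hj => ?_) l
      exact (mem_filter.1 (natAdd_mem_coordSet.1 hj)).2
    have hβ₀ : 0 ≤ β := (addressProb_nonneg τ (τ 1)).trans (hβ _)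
    calc correlation (addressing τ s) g ≤ ∑ j ∈ B, addressProb τ j :=
          correlation_addressing_le_sum τ s hg
      _ ≤ #B * β := by simpa using sum_le_card_nsmul B _ β fun j _ => hβ j
      _ ≤ ((k : ℝ) - r) * β := by
          have : (r : ℝ) + #B ≤ k := by exact_mod_cast hB
          gcongr
          linarith
      _ ≤ 2 / 3 := hk
  · push Not at haddress
    obtain ⟨i, hi⟩ := haddress
    have hhalf := correlation_addressing_le_half (fun x => hτ x i) s
      (comp_flipAt_of_dependsOn hg hi)
    linarith

end Addressing

section Indistinguishability

variable {r M N : ℕ}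

/-- The sequences of `N` responses, each with exactly one data bit, whose data bits are pairwise
distinct. They are parametrised by the sets of address bits and by the sequence of data bits. -/
def freshResponse :
    (Fin N → Finset (Fin r)) × (Fin N ↪ Fin M) ↪ (Fin N → Finset (Fin (r + M))) where
  toFun v i := coordSet (v.1 i) {v.2 i}
  inj' v w h := by
    have hi (i : Fin N) := coordSet_inj.1 (congrFun h i)
    exact Prod.ext (funext fun i => (hi i).1)
      (DFunLike.ext _ _ fun i => singleton_injective (hi i).2)

theorem one_sub_le_sum_responseProb_freshResponse {τ : Cube r → Fin M} {β : ℝ}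
    (hβ : ∀ j, addressProb τ j ≤ β) (s : Cube r → ℤˣ) (N : ℕ) :
    1 - (N : ℝ) ^ 2 * β ≤
      ∑ S ∈ univ.map (freshResponse (N := N)), responseProb (addressing τ s) S := by
  have hdata (e : Fin N ↪ Fin M) : ∑ T, responseProb (addressing τ s) (freshResponse (T, e)) =
      ∏ i, addressProb τ (e i) := by
    simp only [← sum_boolFourierCoeff_addressing_sq τ s]
    rw [prod_univ_sum, Fintype.piFinset_univ]
    rfl
  rw [sum_map, Fintype.sum_prod_type_right]
  simp only [hdata]
  exact one_sub_sq_mul_le_sum_embedding_prod (addressProb_nonneg τ) (sum_addressProb τ) hβ N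

theorem boolFourierCoeff_addressing_perm_comp {τ : Cube r → Fin M} {T T' : Finset (Fin r)}
    {j : Fin M} {u : Cube r → ℤˣ} (hu : ∀ x, τ x = j → u x = unitParity T x * unitParity T' x)
    (s : Cube r → ℤˣ) (π : Equiv.Perm (Fin M)) :
    boolFourierCoeff (addressing (π ∘ τ) (s * u)) (coordSet T' {π j}) =
      boolFourierCoeff (addressing τ s) (coordSet T {j}) := by
  simp only [boolFourierCoeff_addressing, Function.comp_apply, π.injective.eq_iff]
  refine expect_congr rfl fun x _ => ?_
  split_ifs with hx
  · rw [Pi.mul_apply, hu x hx, ← coe_unitParity, ← coe_unitParity]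
    push_cast
    rw [mul_assoc, mul_assoc, intUnit_cast_mul_self, mul_one]
  · rfl

/-- The probability that `N` oracle calls return the responses `S` when the unknown function is an
addressing function with randomly permuted data bits and random signs. -/
def meanResponseProb (τ : Cube r → Fin M) (S : Fin N → Finset (Fin (r + M))) : ℝ :=
  𝔼 ω : Equiv.Perm (Fin M) × (Cube r → ℤˣ), responseProb (addressing (ω.1 ∘ τ) ω.2) S

theorem meanResponseProb_nonneg (τ : Cube r → Fin M) (S : Fin N → Finset (Fin (r + M))) :
    0 ≤ meanResponseProb τ S :=
  expect_nonneg fun _ _ => responseProb_nonneg _ S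

theorem sum_meanResponseProb_mul (τ : Cube r → Fin M) (V : Finset (Fin N → Finset (Fin (r + M))))
    (w : (Fin N → Finset (Fin (r + M))) → ℝ) :
    ∑ S ∈ V, meanResponseProb τ S * w S = 𝔼 ω : Equiv.Perm (Fin M) × (Cube r → ℤˣ),
      ∑ S ∈ V, responseProb (addressing (ω.1 ∘ τ) ω.2) S * w S := by
  simp only [meanResponseProb, expect_mul]
  exact (expect_sum_comm _ _ _).symm

theorem sum_meanResponseProb (τ : Cube r → Fin M) (N : ℕ) :
    ∑ S : Fin N → Finset (Fin (r + M)), meanResponseProb τ S = 1 := by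
  simpa [sum_responseProb] using sum_meanResponseProb_mul (N := N) τ univ 1

theorem one_sub_le_sum_meanResponseProb_freshResponse {τ : Cube r → Fin M} {β : ℝ}
    (hβ : ∀ j, addressProb τ j ≤ β) (N : ℕ) :
    1 - (N : ℝ) ^ 2 * β ≤ ∑ S ∈ univ.map (freshResponse (N := N)), meanResponseProb τ S := by
  have hmean := sum_meanResponseProb_mul τ (univ.map (freshResponse (N := N))) 1
  simp only [Pi.one_apply, mul_one] at hmean
  rw [hmean]
  refine le_expect univ_nonempty fun ω _ =>
    one_sub_le_sum_responseProb_freshResponse (fun j => ?_) ω.2 N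
  rw [addressProb_perm_comp]
  exact hβ _

/-- A permutation of the data bits takes the data bits of one fresh sequence to those of the other.
As the fibers of `τ` over these data bits are disjoint, the signs can be multiplied by a different
parity function on each of them, which changes the sets of address bits at will. -/
theorem meanResponseProb_freshResponse_eq (τ : Cube r → Fin M)
    (v w : (Fin N → Finset (Fin r)) × (Fin N ↪ Fin M)) :
    meanResponseProb τ (freshResponse v) = meanResponseProb τ (freshResponse w) := by
  obtain ⟨ρ, hρ⟩ := MulAction.isMultiplyPretransitive_iff.1
    (Equiv.Perm.isMultiplyPretransitive (Fin M) N) v.2 w.2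
  let u : Fin M → Cube r → ℤˣ :=
    Function.extend v.2 (fun i => unitParity (v.1 i) * unitParity (w.1 i)) 1
  have hu (i : Fin N) : u (v.2 i) = unitParity (v.1 i) * unitParity (w.1 i) :=
    v.2.injective.extend_apply _ _ i
  let e : Equiv.Perm (Fin M) × (Cube r → ℤˣ) ≃ Equiv.Perm (Fin M) × (Cube r → ℤˣ) :=
    Equiv.prodShear (Equiv.mulLeft ρ) fun π => Equiv.mulRight fun x => u (π (τ x)) x
  refine Fintype.expect_equiv e _ _ fun ω => prod_congr rfl fun i _ => congrArg (· ^ 2) ?_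
  have hw : w.2 i = ρ (v.2 i) := (DFunLike.congr_fun hρ i).symm
  change _ = boolFourierCoeff (addressing (ρ ∘ (ω.1 ∘ τ)) (ω.2 * fun x => u (ω.1 (τ x)) x))
    (coordSet (w.1 i) {w.2 i})
  rw [hw]
  refine (boolFourierCoeff_addressing_perm_comp (fun x hx => ?_) ω.2 ρ).symm
  have hx' : ω.1 (τ x) = v.2 i := hx
  rw [hx', hu, Pi.mul_apply]

theorem FSAlgorithm.MakesAtMost.acceptance_gap_le {A : FSAlgorithm (r + M)}
    (hN : A.MakesAtMost N) {τ τ' : Cube r → Fin M} {a b β : ℝ}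
    (hβ : ∀ j, addressProb τ j ≤ β) (hβ' : ∀ j, addressProb τ' j ≤ β)
    (ha : ∀ (π : Equiv.Perm (Fin M)) s, a ≤ (A.output (addressing (π ∘ τ) s) true).toReal)
    (hb : ∀ (π : Equiv.Perm (Fin M)) s, (A.output (addressing (π ∘ τ') s) true).toReal ≤ b) :
    a - b ≤ (N : ℝ) ^ 2 * β := by
  have hconst (σ : Cube r → Fin M) : ∀ S ∈ univ.map (freshResponse (N := N)),
      ∀ S' ∈ univ.map (freshResponse (N := N)), meanResponseProb σ S = meanResponseProb σ S' := by
    simp only [mem_map, mem_univ, true_and]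
    rintro _ ⟨v, rfl⟩ _ ⟨w, rfl⟩
    exact meanResponseProb_freshResponse_eq σ v w
  have hgap := sum_mul_sub_sum_mul_le (meanResponseProb_nonneg τ) (meanResponseProb_nonneg τ')
    (sum_meanResponseProb τ N) (hconst τ) (hconst τ')
    (one_sub_le_sum_meanResponseProb_freshResponse hβ N)
    (one_sub_le_sum_meanResponseProb_freshResponse hβ' N) A.acceptProb_mem_Icc
  simp only [sum_meanResponseProb_mul, ← hN.toReal_output_true] at hgap
  have ha' := le_expect univ_nonempty
    fun (ω : Equiv.Perm (Fin M) × (Cube r → ℤˣ)) _ => ha ω.1 ω.2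
  have hb' := expect_le univ_nonempty
    fun (ω : Equiv.Perm (Fin M) × (Cube r → ℤˣ)) _ => hb ω.1 ω.2
  linarith

end Indistinguishability

section BalancedAddresses

variable {r m M k t : ℕ}

/-- The two signs as binary digits, in an unspecified order. -/
def signDigit : ℤˣ ≃ Fin 2 :=
  Fintype.equivFinOfCardEq Fintype.card_units_int

theorem natAbs_signDigit_neg_sub (u : ℤˣ) :
    ((signDigit (-u) : ℤ) - (signDigit u : ℤ)).natAbs = 1 := by
  have hne : signDigit (-u) ≠ signDigit u := signDigit.injective.ne (units_ne_neg_self u).symm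
  omega

/-- The points of the cube as numbers written in binary. -/
def cubeIndex (r : ℕ) : Cube r ≃ Fin (2 ^ r) :=
  (Equiv.arrowCongr (Equiv.refl (Fin r)) signDigit).trans finFunctionFinEquiv

theorem cubeIndex_val (x : Cube r) :
    (cubeIndex r x : ℕ) = ∑ i, (signDigit (x i) : ℕ) * 2 ^ (i : ℕ) := by
  simp [cubeIndex]

theorem natAbs_cubeIndex_flipAt_sub (i : Fin r) (x : Cube r) :
    ((cubeIndex r (flipAt i x) : ℤ) - (cubeIndex r x : ℤ)).natAbs = 2 ^ (i : ℕ) := by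
  have hsub : (cubeIndex r (flipAt i x) : ℤ) - (cubeIndex r x : ℤ) =
      ((signDigit (-x i) : ℤ) - (signDigit (x i) : ℤ)) * 2 ^ (i : ℕ) := by
    simp only [cubeIndex_val, Nat.cast_sum, Nat.cast_mul, Nat.cast_pow, Nat.cast_ofNat,
      ← sum_sub_distrib, ← sub_mul]
    rw [Fintype.sum_eq_single i fun l hl => by rw [flipAt_of_ne hl, sub_self, zero_mul],
      flipAt_same]
  rw [hsub, Int.natAbs_mul, natAbs_signDigit_neg_sub, one_mul, Int.natAbs_pow]
  rfl

/-- The address map that reads the address as a binary number and reduces it modulo `m`. It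
distributes the addresses almost evenly over the first `m` data bits. -/
def modAddress (r : ℕ) (hm : 0 < m) (hmM : m ≤ M) (x : Cube r) : Fin M :=
  Fin.castLE hmM ⟨cubeIndex r x % m, Nat.mod_lt _ hm⟩

theorem modAddress_flipAt_ne (hm : 0 < m) (hmM : m ≤ M) {i : Fin r} (hi : ¬ m ∣ 2 ^ (i : ℕ))
    (x : Cube r) : modAddress r hm hmM (flipAt i x) ≠ modAddress r hm hmM x := fun h => by
  have hmod : (cubeIndex r x : ℕ) ≡ cubeIndex r (flipAt i x) [MOD m] := (congrArg Fin.val h).symm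
  rw [Nat.modEq_iff_dvd, Int.natCast_dvd, natAbs_cubeIndex_flipAt_sub] at hmod
  exact hi hmod

theorem addressProb_modAddress_le (hm : 0 < m) (hmM : m ≤ M) (j : Fin M) :
    addressProb (modAddress r hm hmM) j ≤ 1 / m + 1 / 2 ^ r := by
  have hcount : Nat.count (fun a => a ≡ j [MOD m]) (2 ^ r) ≤ 2 ^ r / m + 1 := by
    rw [Nat.count_modEq_card _ hm]
    split_ifs <;> omega
  have hcard : #{x | modAddress r hm hmM x = j} ≤ 2 ^ r / m + 1 := by
    refine le_trans ?_ hcount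
    rw [Nat.count_eq_card_filter_range]
    refine card_le_card_of_injOn (fun x => (cubeIndex r x : ℕ)) (fun x hx => ?_)
      (Fin.val_injective.comp (cubeIndex r).injective).injOn
    have hval : (cubeIndex r x : ℕ) % m = j := congrArg Fin.val (mem_filter.1 hx).2
    refine mem_filter.2 ⟨mem_range.2 (cubeIndex r x).2, ?_⟩
    rw [Nat.ModEq, ← hval, Nat.mod_mod]
  have hreal : (#{x | modAddress r hm hmM x = j} : ℝ) ≤ 2 ^ r / m + 1 :=
    (Nat.cast_le.2 hcard).trans (by push_cast; gcongr; exact_mod_cast Nat.cast_div_le)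
  calc addressProb (modAddress r hm hmM) j
      = #{x | modAddress r hm hmM x = j} / 2 ^ r := by
        rw [addressProb, Fintype.expect_eq_sum_div_card, sum_boole]
        simp
    _ ≤ (2 ^ r / m + 1) / 2 ^ r := by gcongr
    _ = 1 / m + 1 / 2 ^ r := by field_simp

theorem addressProb_modAddress_le_four_div (hk : 0 < k) (hkr : k ^ 2 ≤ 2 ^ r) (hkm : k ≤ 2 * m)
    (hm : 0 < m) (hmM : m ≤ M) (j : Fin M) : addressProb (modAddress r hm hmM) j ≤ 4 / k := by
  have hk₀ : (0 : ℝ) < k := Nat.cast_pos.2 hk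
  have hm₀ : (0 : ℝ) < m := Nat.cast_pos.2 hm
  have hmk : (1 : ℝ) / m ≤ 2 / k := by
    rw [div_le_div_iff₀ hm₀ hk₀, one_mul]
    exact_mod_cast hkm
  have hrk : (1 : ℝ) / 2 ^ r ≤ 2 / k := by
    rw [div_le_div_iff₀ (by positivity) hk₀, one_mul]
    exact_mod_cast (Nat.le_self_pow two_ne_zero k).trans (hkr.trans (by omega))
  calc addressProb (modAddress r hm hmM) j ≤ 1 / m + 1 / 2 ^ r := addressProb_modAddress_le hm hmM j
    _ ≤ 2 / k + 2 / k := add_le_add hmk hrk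
    _ = 4 / k := by ring

theorem isJunta_addressing_modAddress (hm : 0 < m) (hmM : m ≤ M) (hk : r + m ≤ k)
    (π : Equiv.Perm (Fin M)) (s : Cube r → ℤˣ) :
    IsJunta k (addressing (π ∘ modAddress r hm hmM) s) := by
  refine isJunta_addressing (B := univ.image (π ∘ Fin.castLE hmM))
    (fun x => mem_image_of_mem (π ∘ Fin.castLE hmM) (mem_univ _)) (le_trans ?_ hk) s
  gcongr
  exact card_image_le.trans_eq (card_fin m)

/-- With `3 * t` data bits, a function of `k` variables that reads all address bits sees fewer than
`2 * t` data bits. -/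
theorem farFromJuntas_addressing_modAddress {ε : ℝ} (hε : ε ≤ 1 / 6) (hm : 0 < 3 * t)
    (hmM : 3 * t ≤ M) (hk : k + 2 ≤ 2 * t + r) (ht : 3 * t ^ 2 ≤ 2 ^ r)
    (π : Equiv.Perm (Fin M)) (s : Cube r → ℤˣ) :
    FarFromJuntas k ε (addressing (π ∘ modAddress r hm hmM) s) := by
  have hdvd (i : Fin r) : ¬ 3 * t ∣ 2 ^ (i : ℕ) := fun h =>
    absurd (Nat.prime_three.dvd_of_dvd_pow (dvd_of_mul_right_dvd h)) (by norm_num)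
  refine farFromJuntas_addressing (β := 1 / (3 * t : ℕ) + 1 / 2 ^ r)
    (fun x i => π.injective.ne (modAddress_flipAt_ne hm hmM (hdvd i) x)) (fun j => ?_) ?_ hε s
  · rw [addressProb_perm_comp]
    exact addressProb_modAddress_le hm hmM _
  · have ht₀ : (0 : ℝ) < t := Nat.cast_pos.2 (by omega)
    have hk' : (k : ℝ) - r ≤ 2 * t - 2 := by
      have : (k : ℝ) + 2 ≤ 2 * t + r := by exact_mod_cast hk
      linarith
    have hr : (1 : ℝ) / 2 ^ r ≤ 1 / (3 * t ^ 2) :=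
      one_div_le_one_div_of_le (by positivity) (by exact_mod_cast ht)
    calc ((k : ℝ) - r) * (1 / (3 * t : ℕ) + 1 / 2 ^ r)
        ≤ (2 * t - 2) * (1 / (3 * t : ℕ) + 1 / (3 * t ^ 2)) := by
          have : (1 : ℝ) ≤ t := by exact_mod_cast Nat.pos_of_ne_zero (by omega)
          gcongr
          linarith
      _ = 2 / 3 - 2 / (3 * t ^ 2) := by
          push_cast
          field_simp
          ring
      _ ≤ 2 / 3 := sub_le_self _ (by positivity)

end BalancedAddresses

/-! ### The lower bound -/

section LowerBound

variable {n r M k t N : ℕ} {ε : ℝ}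

theorem FSAlgorithm.TestsJunta.one_le_of_lt {A : FSAlgorithm n} (hA : A.TestsJunta k ε)
    (hN : A.MakesAtMost N) (hk : k < n) (hε : ε ≤ 1 / 2) : 1 ≤ N := by
  by_contra! hlt
  obtain rfl : N = 0 := Nat.lt_one_iff.1 hlt
  have hyes := hA.two_thirds_le_of_isJunta (isJunta_one k)
  have hno := hA.le_one_third_of_farFromJuntas (farFromJuntas_unitParity_univ hk hε)
  rw [hN.output_eq_of_zero 1 (unitParity univ)] at hyes
  linarith

theorem FSAlgorithm.TestsJunta.le_twelve_mul_sq {A : FSAlgorithm (r + M)}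
    (hA : A.TestsJunta k ε) (hN : A.MakesAtMost N) (hε : ε ≤ 1 / 6) (hk : 0 < k)
    (hrk : 2 * r ≤ k) (hkr : k ^ 2 ≤ 2 ^ r) (ht : k + 2 ≤ 2 * t + r) (htk : 2 * t ≤ k)
    (htM : 3 * t ≤ M) : (k : ℝ) ≤ 12 * N ^ 2 := by
  have hyes : 0 < k - r := by omega
  have hno : 0 < 3 * t := by omega
  have ht₂ : 3 * t ^ 2 ≤ 2 ^ r := le_trans (by nlinarith) hkr
  have hgap := hN.acceptance_gap_le (a := 2 / 3) (b := 1 / 3)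
    (addressProb_modAddress_le_four_div hk hkr (by omega) hyes (by omega))
    (addressProb_modAddress_le_four_div hk hkr (by omega) hno htM)
    (fun π s => hA.two_thirds_le_of_isJunta
      (isJunta_addressing_modAddress hyes _ (by omega) π s))
    (fun π s => hA.le_one_third_of_farFromJuntas
      (farFromJuntas_addressing_modAddress hε hno htM ht ht₂ π s))
  have hk₀ : (0 : ℝ) < k := Nat.cast_pos.2 hk
  rw [mul_div_assoc', le_div_iff₀ hk₀] at hgap
  linarith

theorem four_mul_add_three_le_two_pow {q : ℕ} (hq : 5 ≤ q) : 4 * q + 3 ≤ 2 ^ q := by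
  induction q, hq using Nat.le_induction with
  | base => norm_num
  | succ q _ ih => rw [pow_succ]; omega

theorem four_mul_clog_two_le (hk : 20 ≤ k) : 4 * Nat.clog 2 k ≤ k := by
  by_contra! hlt
  have hle : Nat.clog 2 k ≤ k / 4 :=
    Nat.clog_le_of_le_pow <| le_trans (by omega)
      (four_mul_add_three_le_two_pow (q := k / 4) (by omega))
  omega

theorem FSAlgorithm.TestsJunta.le_twelve_mul_sq_of_twenty_le {A : FSAlgorithm n}
    (hA : A.TestsJunta k ε) (hN : A.MakesAtMost N) (hε : ε ≤ 1 / 6) (hk : 20 ≤ k)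
    (hkn : 3 * k ≤ 2 * n) : (k : ℝ) ≤ 12 * N ^ 2 := by
  have hlog : 4 * Nat.clog 2 k ≤ k := four_mul_clog_two_le hk
  have hlog₅ : 4 < Nat.clog 2 k := (Nat.lt_clog_iff_pow_lt one_lt_two).2 (by omega)
  have hpow : k ^ 2 ≤ 2 ^ (2 * Nat.clog 2 k) := by
    rw [mul_comm, pow_mul]
    exact Nat.pow_le_pow_left (Nat.le_pow_clog one_lt_two k) 2
  obtain ⟨M, rfl⟩ : ∃ M, n = 2 * Nat.clog 2 k + M := Nat.exists_eq_add_of_le (by omega)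
  exact hA.le_twelve_mul_sq (t := (k - 2 * Nat.clog 2 k + 3) / 2) hN hε (by omega) (by omega) hpow
    (by omega) (by omega) (by omega)

theorem FSAlgorithm.TestsJunta.le_sq {A : FSAlgorithm n} (hA : A.TestsJunta k ε)
    (hN : A.MakesAtMost N) (hε : ε ≤ 1 / 6) (hkn : 3 * k ≤ 2 * n) :
    (k : ℝ) ≤ 25 * N ^ 2 := by
  rcases Nat.eq_zero_or_pos k with rfl | hk
  · simp
  rcases lt_or_ge k 20 with hlt | hge
  · have hN₁ : 1 ≤ N := hA.one_le_of_lt hN (by omega) (hε.trans (by norm_num))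
    exact_mod_cast (show k ≤ 25 * N ^ 2 by nlinarith)
  · linarith [hA.le_twelve_mul_sq_of_twenty_le hN hε hge hkn, sq_nonneg (N : ℝ)]

end LowerBound

end

theorem mainTheorem2 :
    ∃ c : ℝ, 0 < c ∧
      ∀ (n k : ℕ) (ε : ℝ), 3 * k ≤ 2 * n → 0 < ε → ε ≤ 1 / 6 →
        ∀ (A : FSAlgorithm n) (N : ℕ), A.TestsJunta k ε → A.MakesAtMost N →
          c * Real.sqrt (k : ℝ) ≤ (N : ℝ) := by
  refine ⟨1 / 5, by norm_num, fun n k ε hkn _ hε A N hA hN => ?_⟩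
  have hsqrt : Real.sqrt k ≤ 5 * N :=
    Real.sqrt_le_iff.2 ⟨by positivity, (hA.le_sq hN hε hkn).trans_eq (by ring)⟩
  linarith
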